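/- For $d>0$ let $\mathscr{D}_d=\{\zeta\in\mathbb{C}:|\operatorname{Im}\zeta|<d\}$, and let $B(\mathscr{D}_d)$ be the family of all functions $f$ that are analytic on $\mathscr{D}_d$ and satisfy the following two conditions: the limit $$\Lambda(f,d):=\lim_{c\to d-0}\int_{-\infty}^{\infty}\bigl(|f(x+\mathrm{i}c)|+|f(x-\mathrm{i}c)|\bigr)\,dx$$ exists and is finite, and $$\lim_{x\to\pm\infty}\int_{-d}^{d}|f(x+\mathrm{i}y)|\,dy=0 .$$ For $h>0$, $j\in\mathbb{Z}$ and $x\in\mathbb{R}$ let $$J(j,h)(x)=\int_{-\infty}^{x}\operatorname{sinc}\Bigl(\frac{u-jh}{h}\Bigr)\,du=\lim_{a\to-\infty}\int_a^x\operatorname{sinc}\Bigl(\frac{u-jh}{h}\Bigr)\,du,$$ where $\operatorname{sinc}(t)=\sin(\pi t)/(\pi t)$ for $t\neq 0$ and $\operatorname{sinc}(0)=1$. **Theorem 4.4.** Let $d>0$ and $f\in B(\mathscr{D}_d)$. Then, for every $h>0$, $f$ is integrable on $\mathbb{R}$, the series $\sum_{j=-\infty}^{\infty}f(jh)J(j,h)(x)$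 converges absolutely for every $x\in\mathbb{R}$, and $$\sup_{x\in\mathbb{R}}\left|\int_{-\infty}^{x}f(t)\,dt-\sum_{j=-\infty}^{\infty}f(jh)\,J(j,h)(x)\right|\le\frac{4h\,e^{-\pi d/h}}{\pi d\,(1-e^{-2\pi d/h})}\,\Lambda(f,d).$$ -/

import Mathlib

open MeasureTheory Filter Topology Set
open scoped ENNReal

namespace SincIndef

/-- The open strip `{ζ : |Im ζ| < d}`. -/
def strip (d : ℝ) : Set ℂ := {ζ | |ζ.im| < d}

/-- `∫_{-∞}^{∞} (|f(x + ic)| + |f(x - ic)|) dx`, with values in `[0, ∞]`. -/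
noncomputable def lineIntegral (f : ℂ → ℂ) (c : ℝ) : ℝ≥0∞ :=
  ∫⁻ x : ℝ, (‖f (x + Complex.I * c)‖ₑ + ‖f (x - Complex.I * c)‖ₑ)

/-- `Λ(f, d)`: the limit of `lineIntegral f c` as `c → d - 0`. It is meaningful when the limit
exists, which is part of the membership `InB f d` below. -/
noncomputable def Lam (f : ℂ → ℂ) (d : ℝ) : ℝ≥0∞ :=
  limUnder (𝓝[<] d) (lineIntegral f)

/-- `∫_{-d}^{d} |f(x + iy)| dy`, with values in `[0, ∞]`. -/
noncomputable def verticalIntegral (f : ℂ → ℂ) (d x : ℝ) : ℝ≥0∞ :=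
  ∫⁻ y in Ioo (-d) d, ‖f (x + Complex.I * y)‖ₑ

/-- The function space `B(𝒟_d)` on the strip of half-width `d`. -/
structure InB (f : ℂ → ℂ) (d : ℝ) : Prop where
  analytic : AnalyticOnNhd ℂ f (strip d)
  tendsto_Lam : Tendsto (lineIntegral f) (𝓝[<] d) (𝓝 (Lam f d))
  Lam_lt_top : Lam f d < ∞
  vertical_atTop : Tendsto (verticalIntegral f d) atTop (𝓝 0)
  vertical_atBot : Tendsto (verticalIntegral f d) atBot (𝓝 0)

/-- The normalized sinc function `sin(πx)/(πx)`, with value `1` at `0`. -/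
noncomputable def nsinc (x : ℝ) : ℝ := Real.sinc (Real.pi * x)

/-- `J(j,h)(x) = ∫_{-∞}^x sinc((u - jh)/h) du`. The integral is only conditionally convergent, so
it is the improper integral, i.e. the limit of `∫_a^x` as `a → -∞`; the limit exists for every
`h > 0`, see `tendsto_J`. -/
noncomputable def J (j : ℤ) (h x : ℝ) : ℝ :=
  limUnder atBot (fun a : ℝ => ∫ u in a..x, nsinc ((u - j * h) / h))

lemma exists_tendsto_sinc (x : ℝ) :
    ∃ l : ℝ, Tendsto (fun a : ℝ => ∫ t in a..x, Real.sinc t) atBot (𝓝 l) := by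
  have hint : IntegrableOn (fun t : ℝ => (1 - Real.cos t) / t ^ 2) (Iic (-1)) := by
    refine Integrable.mono' (g := fun t : ℝ => 4 * (1 + t ^ 2)⁻¹)
      ((integrable_inv_one_add_sq.const_mul 4).integrableOn) ?_ ?_
    · exact (by fun_prop : Measurable fun t : ℝ => (1 - Real.cos t) / t ^ 2).aestronglyMeasurable
    · refine (ae_restrict_iff' measurableSet_Iic).2 (ae_of_all _ fun t ht => ?_)
      have ht' : t ≤ -1 := ht
      have h1 : 1 ≤ t ^ 2 := by nlinarith
      have h2 := Real.neg_one_le_cos t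
      have h3 := Real.cos_le_one t
      rw [Real.norm_eq_abs, abs_of_nonneg (by apply div_nonneg <;> nlinarith),
        ← div_eq_mul_inv, div_le_div_iff₀ (by linarith) (by linarith)]
      nlinarith
  have hlim := intervalIntegral_tendsto_integral_Iic (-1) hint tendsto_id
  have hF : Tendsto (fun a : ℝ => (1 - Real.cos a) / a) atBot (𝓝 0) := by
    have h0 : Tendsto (fun a : ℝ => 2 * |a|⁻¹) atBot (𝓝 0) := by
      simpa using (tendsto_inv_atTop_zero.comp tendsto_abs_atBot_atTop).const_mul (2 : ℝ)
    refine squeeze_zero_norm (fun a => ?_) h0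
    rw [Real.norm_eq_abs, abs_div, div_eq_mul_inv]
    have h2 := Real.neg_one_le_cos a
    have h3 := Real.cos_le_one a
    gcongr
    rw [abs_le]
    constructor <;> linarith
  have hcont : ∀ a b : ℝ, IntervalIntegrable Real.sinc volume a b :=
    fun a b => Real.continuous_sinc.intervalIntegrable a b
  refine ⟨_, Tendsto.congr' ?_
    (((hlim.add_const ((1 - Real.cos (-1)) / (-1))).sub hF).add_const
      (∫ t in (-1 : ℝ)..x, Real.sinc t))⟩
  filter_upwards [eventually_le_atBot (-1 : ℝ)] with a ha
  rw [← intervalIntegral.integral_add_adjacent_intervals (hcont a (-1)) (hcont (-1) x)]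
  congr 1
  have hp : IntervalIntegrable (fun t : ℝ => (1 - Real.cos t) / t ^ 2) volume a (-1) := by
    rw [intervalIntegrable_iff_integrableOn_Ioc_of_le ha]
    exact hint.mono_set fun t ht => ht.2
  have hftc : ∫ t in a..(-1), (Real.sinc t - (1 - Real.cos t) / t ^ 2)
      = (1 - Real.cos (-1)) / (-1) - (1 - Real.cos a) / a := by
    refine intervalIntegral.integral_eq_sub_of_hasDerivAt
      (f := fun t : ℝ => (1 - Real.cos t) / t) (fun t ht => ?_) ((hcont _ _).sub hp)
    rw [uIcc_of_le ha] at ht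
    have ht0 : t ≠ 0 := by linarith [ht.2]
    rw [Real.sinc_of_ne_zero ht0]
    have := ((Real.hasDerivAt_cos t).const_sub 1).div (hasDerivAt_id t) ht0
    refine this.congr_deriv ?_
    simp only [id]
    field_simp
  rw [intervalIntegral.integral_sub (hcont _ _) hp] at hftc
  simp only [id]
  linarith

/-- The improper integral that defines `J` converges. -/
lemma tendsto_J (j : ℤ) {h : ℝ} (hh : 0 < h) (x : ℝ) :
    Tendsto (fun a : ℝ => ∫ u in a..x, nsinc ((u - j * h) / h)) atBot (𝓝 (J j h x)) := by
  refine tendsto_nhds_limUnder ?_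
  obtain ⟨l, hl⟩ := exists_tendsto_sinc (Real.pi / h * x - Real.pi * j)
  have hpi : 0 < Real.pi / h := div_pos Real.pi_pos hh
  refine ⟨(Real.pi / h)⁻¹ * l, ?_⟩
  have hsub : Tendsto (fun a : ℝ => Real.pi / h * a - Real.pi * j) atBot atBot :=
    tendsto_atBot_add_const_right _ _ (tendsto_id.const_mul_atBot hpi)
  refine ((hl.comp hsub).const_mul (Real.pi / h)⁻¹).congr fun a => ?_
  have := intervalIntegral.integral_comp_mul_sub (a := a) (b := x) (fun t => Real.sinc t)
    hpi.ne' (Real.pi * j)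
  simp only [smul_eq_mul] at this
  simp only [Function.comp, nsinc]
  rw [← this]
  congr 1
  ext u
  congr 1
  field_simp

end SincIndef

/-! Fix 0 < c < d with finite line integral at height c. Cauchy's formula writes `f t` as an
integral of f(ζ)/(ζ - t) over the lines Im ζ = ±c. Partial fractions of the cosecant give the sinc
interpolant of t ↦ 1/(ζ - t) exactly: it misses the function by sin(πt/h) / (sin(πζ/h) (ζ - t))
(`hasSum_nsinc_div_sub`). Exchanging sum and integral, the interpolation error of f at t is
sin(πt/h)/(2πi) times a difference of Cauchy transforms of f(ζ)/sin(πζ/h)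
(`interpolation_error_eq`).

The error is then integrated over [a, x]. By Fubini only ∫ sin(πt/h)/(ζ - t) dt matters; integration
by parts bounds it by 4h/c, uniformly in a and x (`norm_integral_sin_div_le`). On the lines
|sin(πζ/h)| ≥ sinh(πc/h), which yields the exponential factor. Finally a → -∞, then c → d.

Both exchanges of limits need Σ |f(jh)| < ∞. The Cauchy kernel decays too slowly for that, so
Cauchy's formula is applied to f times a Gaussian centred at the point of evaluation
(`enorm_le_lintegral_line`). -/

namespace SincIndef

/-! ### Bounds for sinc, its integrals and lattice sums -/

lemma nsinc_sq_le (u : ℝ) : nsinc u ^ 2 ≤ 2 * (1 + u ^ 2)⁻¹ := by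
  rw [← div_eq_mul_inv, le_div_iff₀ (by positivity)]
  have h1 : nsinc u ^ 2 ≤ 1 := by
    rw [sq_le_one_iff_abs_le_one]; exact Real.abs_sinc_le_one _
  have h2 : nsinc u ^ 2 * u ^ 2 ≤ 1 := by
    rcases eq_or_ne u 0 with rfl | hu
    · simp
    have hpu : Real.pi * u ≠ 0 := mul_ne_zero Real.pi_ne_zero hu
    rw [nsinc, Real.sinc_of_ne_zero hpu, div_pow, mul_pow, div_mul_eq_mul_div,
      div_le_one (by positivity)]
    have hp : 1 ≤ Real.pi ^ 2 := by nlinarith [Real.pi_gt_three]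
    nlinarith [Real.sin_sq_le_one (Real.pi * u), sq_nonneg u]
  linarith

lemma continuous_nsinc : Continuous nsinc := by
  unfold nsinc
  exact Real.continuous_sinc.comp (by fun_prop)

/-- The integral has a limit at -∞ and is continuous, hence bounded for a ≤ 0; evenness of sinc
covers a > 0. -/
lemma exists_abs_integral_sinc_zero_le : ∃ B : ℝ, ∀ a : ℝ, |∫ t in a..0, Real.sinc t| ≤ B := by
  obtain ⟨l, hl⟩ := exists_tendsto_sinc 0
  have hcont : ∀ a b : ℝ, IntervalIntegrable Real.sinc volume a b :=
    fun a b => Real.continuous_sinc.intervalIntegrable a b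
  have hc : Continuous fun a : ℝ => ∫ t in a..0, Real.sinc t := by
    simp_rw [intervalIntegral.integral_symm 0]
    exact (intervalIntegral.continuous_primitive hcont 0).neg
  have hev : ∀ᶠ a in atBot, |∫ t in a..0, Real.sinc t| ≤ |l| + 1 := by
    have := hl.abs.eventually (gt_mem_nhds (lt_add_one |l|))
    exact this.mono fun a ha => ha.le
  obtain ⟨A, hA⟩ := eventually_atBot.1 hev
  obtain ⟨M, hM⟩ := (isCompact_Icc (a := min A 0) (b := 0)).exists_bound_of_continuousOn
    hc.continuousOn
  have hneg : ∀ a ≤ 0, |∫ t in a..0, Real.sinc t| ≤ max (|l| + 1) M := fun a ha => by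
    rcases le_total a A with h | h
    · exact (hA a h).trans (le_max_left _ _)
    · exact (hM a ⟨(min_le_left _ _).trans h, ha⟩).trans (le_max_right _ _)
  refine ⟨max (|l| + 1) M, fun a => ?_⟩
  rcases le_total a 0 with h | h
  · exact hneg a h
  · have := hneg (-a) (by linarith)
    have key := intervalIntegral.integral_comp_neg (a := 0) (b := a) Real.sinc
    simp only [Real.sinc_neg, neg_zero] at key
    rwa [← key, intervalIntegral.integral_symm, abs_neg] at this

/-- Uniformity in `j` and `a` is the point: `B` supplies the dominating sequence B |f(jh)| when a →
-∞. -/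
lemma exists_abs_integral_nsinc_le {h : ℝ} (hh : 0 < h) :
    ∃ B : ℝ, ∀ (j : ℤ) (a x : ℝ), |∫ u in a..x, nsinc ((u - j * h) / h)| ≤ B := by
  obtain ⟨B, hB⟩ := exists_abs_integral_sinc_zero_le
  have hpi : 0 < Real.pi / h := div_pos Real.pi_pos hh
  refine ⟨(Real.pi / h)⁻¹ * (B + B), fun j a x => ?_⟩
  have key := intervalIntegral.integral_comp_mul_sub (a := a) (b := x) (fun t => Real.sinc t)
    hpi.ne' (Real.pi * j)
  have hrw : ∀ u : ℝ, nsinc ((u - j * h) / h) = Real.sinc (Real.pi / h * u - Real.pi * j) := by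
    intro u
    rw [nsinc]
    congr 1
    field_simp
  simp_rw [hrw]
  rw [key, smul_eq_mul, abs_mul, abs_of_pos (inv_pos.2 hpi)]
  gcongr
  have hcont : ∀ a b : ℝ, IntervalIntegrable Real.sinc volume a b :=
    fun a b => Real.continuous_sinc.intervalIntegrable a b
  rw [← intervalIntegral.integral_add_adjacent_intervals (hcont _ 0) (hcont 0 _),
    intervalIntegral.integral_symm _ 0]
  exact (abs_add_le _ _).trans (add_le_add (hB _) ((abs_neg _).trans_le (hB _)))

lemma summable_inv_one_add_mul_sq {h : ℝ} (hh : 0 < h) :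
    Summable fun j : ℤ => (1 + (j * h) ^ 2)⁻¹ := by
  have h2 : Summable fun j : ℤ => (h ^ 2)⁻¹ * (1 / (j : ℝ) ^ 2) :=
    (Real.summable_one_div_int_pow.2 one_lt_two).mul_left _
  refine (summable_of_hasFiniteSupport (f := fun j : ℤ => if j = 0 then (1 : ℝ) else 0) ?_ |>.add
    h2).of_nonneg_of_le (fun j => by positivity) fun j => ?_
  · exact (Set.finite_singleton (0 : ℤ)).subset fun j hj => by
      by_contra h0; simp_all
  · rcases eq_or_ne j 0 with rfl | hj
    · simp
    · have hj' : (j : ℝ) ≠ 0 := by exact_mod_cast hj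
      simp only [hj, if_false, zero_add]
      rw [one_div, ← mul_inv]
      apply inv_anti₀ (by positivity)
      nlinarith

/-- The `h`-periodization of `(1 + s ^ 2)⁻¹` is bounded. -/
lemma exists_tsum_lattice_le {h : ℝ} (hh : 0 < h) : ∃ C : ℝ≥0∞, C ≠ ∞ ∧ ∀ s : ℝ,
    ∑' j : ℤ, ENNReal.ofReal (1 + (s - j * h) ^ 2)⁻¹ ≤ C := by
  have hsum := (summable_inv_one_add_mul_sq hh).mul_left (2 + 2 * h ^ 2)
  -- With r ∈ [0, h] the residue of s modulo h, (jh)² ≤ 2r² + 2(r - jh)² gives 1 + (jh)² ≤ (2 +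
  -- 2h²)(1 + (r - jh)²).
  refine ⟨∑' j : ℤ, ENNReal.ofReal ((2 + 2 * h ^ 2) * (1 + (j * h) ^ 2)⁻¹), ?_, fun s => ?_⟩
  · rw [← ENNReal.ofReal_tsum_of_nonneg (fun j => by positivity) hsum]
    exact ENNReal.ofReal_ne_top
  · rw [← (Equiv.addRight ⌊s / h⌋).tsum_eq]
    refine ENNReal.tsum_le_tsum fun j => ENNReal.ofReal_le_ofReal ?_
    have h1 : ⌊s / h⌋ * h ≤ s := (le_div_iff₀ hh).1 (Int.floor_le _)
    have h2 : s < (⌊s / h⌋ + 1) * h := (div_lt_iff₀ hh).1 (Int.lt_floor_add_one _)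
    simp only [Equiv.coe_addRight, Int.cast_add]
    set m : ℝ := (⌊s / h⌋ : ℝ)
    have hr : s - (j + m) * h = (s - m * h) - j * h := by ring
    rw [hr]
    have hr0 : 0 ≤ s - m * h := by linarith
    have hr1 : s - m * h ≤ h := by linarith
    set r := s - m * h
    rw [← div_eq_mul_inv, inv_eq_one_div, div_le_div_iff₀ (by positivity) (by positivity)]
    nlinarith [sq_nonneg (r - j * h + r), mul_nonneg (sq_nonneg h) (sq_nonneg (r - j * h)),
      pow_le_pow_left₀ hr0 hr1 2]

/-! ### Partial fractions and sinc interpolation of the Cauchy kernel -/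

lemma summable_inv_sub_int_sub (z w : ℂ) (hz : z ∈ Complex.integerComplement)
    (hw : w ∈ Complex.integerComplement) :
    Summable fun j : ℤ => 1 / (z - j) - 1 / (w - j) := by
  have hz' : ∀ j : ℤ, z - j ≠ 0 := fun j h0 => hz ⟨j, (sub_eq_zero.1 h0).symm⟩
  have hw' : ∀ j : ℤ, w - j ≠ 0 := fun j h0 => hw ⟨j, (sub_eq_zero.1 h0).symm⟩
  have h1 : ∀ z : ℂ, Summable fun j : ℤ => ‖(z - j)⁻¹‖ ^ 2 := fun z => by
    refine (EisensteinSeries.linear_right_summable (-z) 1 (k := 2) le_rfl).norm.congr fun j => ?_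
    rw [← norm_pow, inv_pow, show (2 : ℤ) = ((2 : ℕ) : ℤ) from rfl, zpow_natCast]
    congr 2
    push_cast
    ring
  have h2 := (((h1 z).add (h1 w)).mul_left ‖w - z‖)
  refine Summable.of_norm_bounded h2 fun j => ?_
  have : 1 / (z - j) - 1 / (w - j) = (w - z) * ((z - j)⁻¹ * (w - j)⁻¹) := by
    have := hz' j
    have := hw' j
    field_simp
    ring
  rw [this, norm_mul, norm_mul]
  gcongr
  nlinarith [sq_nonneg (‖(z - j)⁻¹‖ - ‖(w - j)⁻¹‖), sq_nonneg ‖(z - j)⁻¹‖,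
    sq_nonneg ‖(w - j)⁻¹‖]

/-- Difference of two Mittag-Leffler expansions of the cotangent. Taking differences makes the terms
O(j⁻²), so that the sum over ℤ is unconditional. -/
lemma hasSum_inv_sub_int_sub (z w : ℂ) (hz : z ∈ Complex.integerComplement)
    (hw : w ∈ Complex.integerComplement) :
    HasSum (fun j : ℤ => 1 / (z - j) - 1 / (w - j))
      (Real.pi * Complex.cot (Real.pi * z) - Real.pi * Complex.cot (Real.pi * w)) := by
  have hS := summable_inv_sub_int_sub z w hz hw
  convert hS.hasSum using 1
  -- Folding ℤ onto ℕ counts the index 0 twice; `h2` removes that term.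
  have h1 := hS.hasSum.nat_add_neg
  have h2 := (hasSum_nat_add_iff' 1).2 h1
  have e1 := cot_series_rep' hz
  have e2 := cot_series_rep' hw
  have s1 : Summable fun n : ℕ => (1 / (z - (n + 1)) + 1 / (z + (n + 1))) := summable_cotTerm hz
  have s2 : Summable fun n : ℕ => (1 / (w - (n + 1)) + 1 / (w + (n + 1))) := summable_cotTerm hw
  have h3 := s1.hasSum.sub s2.hasSum
  rw [← e1, ← e2] at h3
  have h4 : HasSum (fun n : ℕ => (1 / (z - (n + 1)) + 1 / (z + (n + 1))) -
      (1 / (w - (n + 1)) + 1 / (w + (n + 1)))) _ := h2.congr_fun fun n => by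
    push_cast
    ring
  have h5 := h3.unique h4
  simp only [Finset.sum_range_one, Nat.cast_zero, neg_zero, Int.cast_zero, sub_zero] at h5
  linear_combination h5

lemma cot_half_sub_cot (z : ℂ) (hz : z ∈ Complex.integerComplement) :
    Complex.cot (Real.pi * (z / 2)) - Complex.cot (Real.pi * z) = 1 / Complex.sin (Real.pi * z) := by
  have h1 : Complex.sin (Real.pi * z) ≠ 0 := sin_pi_mul_ne_zero hz
  have e : (Real.pi : ℂ) * z = 2 * (Real.pi * (z / 2)) := by ring
  rw [e, Complex.sin_two_mul] at h1
  rw [e, Complex.cot, Complex.cot, Complex.sin_two_mul, Complex.cos_two_mul]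
  set a := (Real.pi : ℂ) * (z / 2)
  have hs : Complex.sin a ≠ 0 := fun h => h1 (by rw [h]; ring)
  have hc : Complex.cos a ≠ 0 := fun h => h1 (by rw [h]; ring)
  field_simp
  ring

lemma half_mem_integerComplement {z : ℂ} (hz : z ∈ Complex.integerComplement) :
    z / 2 ∈ Complex.integerComplement := by
  rintro ⟨n, hn⟩
  exact hz ⟨2 * n, by push_cast; rw [hn]; ring⟩

/-- Since (-1)^j is twice the indicator of the even integers minus 1, and the even terms form the
cotangent series at z/2, the identity cot(πz/2) - cot(πz) = 1/sin(πz) gives the cosecant. -/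
lemma hasSum_alternating_inv_sub_int_sub (z w : ℂ) (hz : z ∈ Complex.integerComplement)
    (hw : w ∈ Complex.integerComplement) :
    HasSum (fun j : ℤ => (-1 : ℂ) ^ j * (1 / (z - j) - 1 / (w - j)))
      (Real.pi / Complex.sin (Real.pi * z) - Real.pi / Complex.sin (Real.pi * w)) := by
  have h1 := hasSum_inv_sub_int_sub z w hz hw
  have h2 := hasSum_inv_sub_int_sub _ _ (half_mem_integerComplement hz)
    (half_mem_integerComplement hw)
  have hinj : Function.Injective fun k : ℤ => 2 * k := fun a b hab => by simpa using hab
  have h3 : HasSum (fun j : ℤ => if Even j then 2 * (1 / (z - j) - 1 / (w - j)) else 0)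
      (Real.pi * Complex.cot (Real.pi * (z / 2)) - Real.pi * Complex.cot (Real.pi * (w / 2))) := by
    rw [← hinj.hasSum_iff]
    · refine h2.congr_fun fun k => ?_
      have e : ∀ v : ℂ, 1 / (v / 2 - k) = 2 * (1 / (v - (2 * k : ℤ))) := fun v => by
        rw [show v / 2 - k = (v - (2 * k : ℤ)) / 2 by push_cast; ring, one_div_div]
        ring
      simp only [Function.comp_apply, even_two_mul, if_true]
      rw [e, e]
      ring
    · intro j hj
      rw [if_neg]
      rintro ⟨k, hk⟩
      exact hj ⟨k, by simp only; omega⟩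
  have h4 := h3.sub h1
  have e1 := cot_half_sub_cot z hz
  have e2 := cot_half_sub_cot w hw
  have hval : (Real.pi / Complex.sin (Real.pi * z) - Real.pi / Complex.sin (Real.pi * w) : ℂ) =
      (Real.pi * Complex.cot (Real.pi * (z / 2)) - Real.pi * Complex.cot (Real.pi * (w / 2))) -
      (Real.pi * Complex.cot (Real.pi * z) - Real.pi * Complex.cot (Real.pi * w)) := by
    linear_combination Real.pi * e2 - Real.pi * e1
  rw [hval]
  refine h4.congr_fun fun j => ?_
  split_ifs with hj
  · rw [hj.neg_one_zpow]; ring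
  · rw [(Int.not_even_iff_odd.1 hj).neg_one_zpow]; ring

/-- Sinc interpolation of `t ↦ 1 / (ζ - t)`, with its error term. -/
lemma hasSum_nsinc_div_sub {h : ℝ} (hh : 0 < h) (t : ℝ) (ζ : ℂ) (hζ : ζ.im ≠ 0) :
    HasSum (fun j : ℤ => (nsinc ((t - j * h) / h) : ℂ) / (ζ - j * h))
      ((1 - Complex.sin (Real.pi * t / h) / Complex.sin (Real.pi * ζ / h)) / (ζ - t)) := by
  have hhC : (h : ℂ) ≠ 0 := by exact_mod_cast hh.ne'
  have hreal : ∀ x : ℝ, ζ - x ≠ 0 := fun x h0 => hζ (by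
    have := congrArg Complex.im h0; simpa using this)
  -- At a node sin(πt/h) vanishes and only one term survives; elsewhere one may divide by it.
  by_cases ht : ∃ m : ℤ, t = m * h
  · obtain ⟨m, rfl⟩ := ht
    have hs : Complex.sin (Real.pi * ((m * h : ℝ) : ℂ) / h) = 0 := by
      rw [Complex.sin_eq_zero_iff]
      exact ⟨m, by push_cast; field_simp⟩
    rw [hs, zero_div, sub_zero]
    convert hasSum_single m fun j hj => ?_ using 1
    · simp [nsinc]
    · have hmj : (m - j : ℝ) ≠ 0 := sub_ne_zero.2 (by exact_mod_cast hj.symm)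
      have e : Real.pi * ((m * h - j * h) / h) = ((m - j : ℤ) : ℝ) * Real.pi := by
        push_cast; field_simp
      rw [nsinc, e, Real.sinc_of_ne_zero, Real.sin_int_mul_pi]
      · simp
      · push_cast
        exact mul_ne_zero hmj Real.pi_ne_zero
  · have hz : ((t / h : ℝ) : ℂ) ∈ Complex.integerComplement := by
      rintro ⟨m, hm⟩
      refine ht ⟨m, ?_⟩
      have : (m : ℝ) = t / h := by exact_mod_cast hm
      rw [this]; field_simp
    have hw : ζ / h ∈ Complex.integerComplement := by
      rintro ⟨m, hm⟩
      refine hreal (m * h) ?_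
      push_cast
      rw [hm]; field_simp; ring
    -- The factor fits because sin(π(t - jh)/h) = (-1)^j sin(πt/h) and 1/(t/h - j) - 1/(ζ/h - j) =
    -- h(ζ - t)/((t - jh)(ζ - jh)).
    have key := (hasSum_alternating_inv_sub_int_sub _ _ hz hw).mul_left
      (Complex.sin (Real.pi * t / h) / (Real.pi * (ζ - t)))
    have hs1 := sin_pi_mul_ne_zero hz
    have hs2 := sin_pi_mul_ne_zero hw
    have e1 : (Real.pi : ℂ) * ((t / h : ℝ) : ℂ) = Real.pi * t / h := by push_cast; ring
    have e2 : (Real.pi : ℂ) * (ζ / h) = Real.pi * ζ / h := by ring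
    rw [e1] at key hs1
    rw [e2] at key hs2
    have hpi : (Real.pi : ℂ) ≠ 0 := by exact_mod_cast Real.pi_ne_zero
    have hval : (1 - Complex.sin (Real.pi * t / h) / Complex.sin (Real.pi * ζ / h)) / (ζ - t) =
        Complex.sin (Real.pi * t / h) / (Real.pi * (ζ - t)) *
      (Real.pi / Complex.sin (Real.pi * t / h) - Real.pi / Complex.sin (Real.pi * ζ / h)) := by
      have h1 := hreal t
      set S := Complex.sin (Real.pi * t / h)
      set S' := Complex.sin (Real.pi * ζ / h)
      field_simp
    rw [hval]
    refine key.congr_fun fun j => ?_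
    have hjt : t / h - j ≠ 0 := fun h0 => ht ⟨j, by
      rw [← sub_eq_zero.1 h0]; field_simp⟩
    have e : Real.pi * ((t - j * h) / h) = Real.pi * t / h - j * Real.pi := by
      field_simp
    have e' : Real.pi * ((t - j * h) / h) = Real.pi * (t / h - j) := by
      field_simp
    have hne : Real.pi * t / h - j * Real.pi ≠ 0 := by
      rw [← e, e']; exact mul_ne_zero Real.pi_ne_zero hjt
    rw [nsinc, e, Real.sinc_of_ne_zero hne, Real.sin_sub_int_mul_pi]
    have h1 := hreal t
    have h2 := hreal (j * h)
    have h3 : (t - j * h : ℂ) ≠ 0 := by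
      norm_cast
      intro h0
      exact ht ⟨j, sub_eq_zero.1 h0⟩
    push_cast at h2 ⊢
    have h4 : (t / h - j : ℂ) = (t - j * h) / h := by field_simp
    have h5 : (ζ / h - j : ℂ) = (ζ - j * h) / h := by field_simp
    have h6 : (Real.pi * t / h - j * Real.pi : ℂ) = Real.pi * (t - j * h) / h := by field_simp
    rw [h4, h5, h6]
    set S := Complex.sin (Real.pi * t / h)
    field_simp
    ring

/-! ### Size of the sine off the real axis, and the oscillatory integral -/

/-- Reverse triangle inequality for the two exponentials, whose moduli are exp(±Im z). -/
lemma sinh_le_norm_sin {b : ℝ} (z : ℂ) (hz : |z.im| = b) :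
    Real.sinh b ≤ ‖Complex.sin z‖ := by
  rw [Complex.sin, norm_div, norm_mul, Complex.norm_I, mul_one, ← hz, Real.sinh_eq]
  have h1 := abs_norm_sub_norm_le (Complex.exp (-z * Complex.I)) (Complex.exp (z * Complex.I))
  rw [Complex.norm_exp, Complex.norm_exp] at h1
  simp only [neg_mul, Complex.neg_re, Complex.mul_re, Complex.I_re, mul_zero, Complex.I_im, mul_one,
    zero_sub, neg_neg] at h1
  have h2 : Real.exp |z.im| - Real.exp (-|z.im|) ≤ |Real.exp z.im - Real.exp (-z.im)| := by
    rcases abs_cases z.im with ⟨h, _⟩ | ⟨h, _⟩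
    · rw [h]; exact le_abs_self _
    · rw [h, neg_neg]; exact (le_abs_self _).trans_eq (abs_sub_comm _ _)
  rw [neg_mul]
  norm_num
  linarith

lemma integrable_poisson {c : ℝ} (hc : 0 < c) (t : ℝ) :
    Integrable fun s : ℝ => ((s - t) ^ 2 + c ^ 2)⁻¹ := by
  have h1 := ((integrable_inv_one_add_sq.comp_div hc.ne').comp_sub_right t).const_mul (c ^ 2)⁻¹
  refine h1.congr (ae_of_all _ fun s => ?_)
  simp only
  rw [← mul_inv]
  congr 1
  field_simp
  ring

lemma integral_poisson {c : ℝ} (hc : 0 < c) (t : ℝ) :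
    ∫ s : ℝ, ((s - t) ^ 2 + c ^ 2)⁻¹ = Real.pi / c := by
  have h1 : ∀ s : ℝ, ((s - t) ^ 2 + c ^ 2)⁻¹ = (c ^ 2)⁻¹ * (1 + ((s - t) / c) ^ 2)⁻¹ := fun s => by
    rw [← mul_inv]
    congr 1
    field_simp
    ring
  simp_rw [h1]
  rw [integral_const_mul, integral_sub_right_eq_self (fun s : ℝ => (1 + (s / c) ^ 2)⁻¹),
    Measure.integral_comp_div (fun s : ℝ => (1 + s ^ 2)⁻¹), integral_univ_inv_one_add_sq,
    abs_of_pos hc, smul_eq_mul]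
  field_simp

lemma norm_sub_ofReal_sq (ζ : ℂ) (t : ℝ) : ‖ζ - t‖ ^ 2 = (t - ζ.re) ^ 2 + |ζ.im| ^ 2 := by
  rw [← Complex.normSq_eq_norm_sq, Complex.normSq_apply, sq_abs]
  simp
  ring

lemma abs_im_le_norm_sub_ofReal (ζ : ℂ) (t : ℝ) : |ζ.im| ≤ ‖ζ - t‖ := by
  simpa using Complex.abs_im_le_norm (ζ - t)

/-- The modulus of 1/(ζ - t) is not integrable over ℝ, so the oscillation must be used. Integration
by parts leaves two boundary terms of size at most h/(πc) and an integral dominated by the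
Poisson-type kernel, at most h/c. -/
lemma norm_integral_sin_div_le {h c : ℝ} (hh : 0 < h) (hc : 0 < c) (ζ : ℂ) (hζ : |ζ.im| = c)
    {a x : ℝ} (hax : a ≤ x) :
    ‖∫ t in a..x, Complex.sin (Real.pi * t / h) / (ζ - t)‖ ≤ 4 * h / c := by
  have hne : ∀ t : ℝ, ζ - t ≠ 0 := fun t h0 => by
    have := abs_im_le_norm_sub_ofReal ζ t
    rw [h0, norm_zero] at this
    linarith
  have hhC : (h : ℂ) ≠ 0 := by exact_mod_cast hh.ne'
  have hpi : (Real.pi : ℂ) ≠ 0 := by exact_mod_cast Real.pi_ne_zero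
  have hcos : ∀ t : ℝ, ‖Complex.cos (Real.pi * t / h)‖ ≤ 1 := fun t => by
    have : Complex.cos (Real.pi * t / h) = (Real.cos (Real.pi * t / h) : ℂ) := by push_cast; rfl
    rw [this, Complex.norm_real]
    exact Real.abs_cos_le_one _
  have hder : ∀ t : ℝ, HasDerivAt
      (fun t : ℝ => -(h / Real.pi) * Complex.cos (Real.pi * t / h) / (ζ - t))
      (Complex.sin (Real.pi * t / h) / (ζ - t) -
        h / Real.pi * (Complex.cos (Real.pi * t / h) / (ζ - t) ^ 2)) t := fun t => by
    have h0 : HasDerivAt (fun z : ℂ => (Real.pi * z / h : ℂ)) (Real.pi / h) (t : ℂ) := by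
      simpa using ((hasDerivAt_id (t : ℂ)).const_mul (Real.pi : ℂ)).div_const (h : ℂ)
    have h1 := (h0.ccos.const_mul (-(h / Real.pi) : ℂ)).div
      ((hasDerivAt_id (t : ℂ)).const_sub ζ) (hne t)
    refine (h1.comp_ofReal).congr_deriv ?_
    have := hne t
    simp only [id]
    field_simp
  have hcs : Continuous fun t : ℝ => Complex.sin (Real.pi * t / h) / (ζ - t) :=
    Continuous.div (by fun_prop) (by fun_prop) hne
  have hcc : Continuous fun t : ℝ => h / Real.pi * (Complex.cos (Real.pi * t / h) / (ζ - t) ^ 2) :=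
    continuous_const.mul (Continuous.div (by fun_prop) (by fun_prop) fun t => pow_ne_zero _ (hne t))
  have hftc := intervalIntegral.integral_eq_sub_of_hasDerivAt (a := a) (b := x)
    (fun t _ => hder t) ((hcs.sub hcc).intervalIntegrable _ _)
  rw [intervalIntegral.integral_sub (hcs.intervalIntegrable _ _) (hcc.intervalIntegrable _ _),
    sub_eq_iff_eq_add] at hftc
  rw [hftc]
  have hb : ∀ t : ℝ, ‖-(h / Real.pi) * Complex.cos (Real.pi * t / h) / (ζ - t)‖ ≤
      h / Real.pi / c := fun t => by
    have h1 := abs_im_le_norm_sub_ofReal ζ t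
    rw [hζ] at h1
    rw [norm_div, norm_mul, norm_neg, norm_div, Complex.norm_real, Complex.norm_real,
      Real.norm_of_nonneg hh.le, Real.norm_of_nonneg Real.pi_pos.le]
    gcongr
    exact mul_le_of_le_one_right (by positivity) (hcos t)
  have hi : ‖∫ t in a..x, h / Real.pi * (Complex.cos (Real.pi * t / h) / (ζ - t) ^ 2)‖ ≤
      h / Real.pi * (Real.pi / c) := by
    have hint := (integrable_poisson hc ζ.re).const_mul (h / Real.pi)
    calc _ ≤ ∫ t in a..x, h / Real.pi * ((t - ζ.re) ^ 2 + c ^ 2)⁻¹ := by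
          refine intervalIntegral.norm_integral_le_of_norm_le hax (ae_of_all _ fun t _ => ?_)
            hint.intervalIntegrable
          rw [norm_mul, norm_div, Complex.norm_real, Complex.norm_real,
            Real.norm_of_nonneg hh.le, Real.norm_of_nonneg Real.pi_pos.le, norm_div, norm_pow,
            norm_sub_ofReal_sq, hζ, ← one_div]
          gcongr
          exact hcos t
      _ ≤ ∫ t, h / Real.pi * ((t - ζ.re) ^ 2 + c ^ 2)⁻¹ := by
          rw [intervalIntegral.integral_of_le hax]
          exact setIntegral_le_integral hint (ae_of_all _ fun t => by positivity)
      _ = _ := by rw [integral_const_mul, integral_poisson hc]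
  refine (norm_add_le _ _).trans (le_trans (add_le_add ((norm_sub_le _ _).trans
    (add_le_add (hb _) (hb _))) hi) ?_)
  -- The total is (1 + 2/π)h/c; this crude estimate already gives 3h/c.
  have : h / Real.pi ≤ h := div_le_self hh.le (by linarith [Real.pi_gt_three])
  have h2 : h / Real.pi * (Real.pi / c) = h / c := by
    field_simp
  rw [h2, ← add_div, ← add_div]
  gcongr
  linarith

/-! ### Cauchy's formula on a strip -/

lemma isOpen_strip (d : ℝ) : IsOpen (strip d) :=
  isOpen_lt (Complex.continuous_im.abs) continuous_const

lemma add_I_mul_mem_strip {c d : ℝ} (h : |c| < d) (x : ℝ) : (x + Complex.I * c : ℂ) ∈ strip d := by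
  simpa [strip] using h

lemma sub_I_mul_mem_strip {c d : ℝ} (h : |c| < d) (x : ℝ) : (x - Complex.I * c : ℂ) ∈ strip d := by
  simpa [strip] using h

lemma ofReal_mem_strip {d : ℝ} (hd : 0 < d) (x : ℝ) : (x : ℂ) ∈ strip d := by
  simpa [strip] using hd

lemma norm_dslope_le {g : ℂ → ℂ} {t R : ℝ} (hR : R ≠ t) (y : ℝ) :
    ‖dslope g t (R + y * Complex.I)‖ ≤
      |R - t|⁻¹ * (‖g (R + Complex.I * y)‖ + ‖g t‖) := by
  have h0 : R - t ≠ 0 := sub_ne_zero.2 hR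
  have hne : (R + y * Complex.I : ℂ) ≠ t := fun h => hR (by
    have := congrArg Complex.re h
    simpa using this)
  have hle : |R - t| ≤ ‖(R + y * Complex.I : ℂ) - t‖ := by
    simpa using Complex.abs_re_le_norm ((R + y * Complex.I : ℂ) - t)
  rw [dslope_of_ne _ hne, slope_def_field, norm_div, div_eq_inv_mul, mul_comm Complex.I]
  have := abs_pos.2 h0
  gcongr
  exact norm_sub_le _ _

section

variable {g : ℂ → ℂ} {c d : ℝ}

lemma differentiableOn_dslope_strip (hd : 0 < d) (hg : DifferentiableOn ℂ g (strip d)) (t : ℝ) :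
    DifferentiableOn ℂ (dslope g t) (strip d) :=
  (Complex.differentiableOn_dslope ((isOpen_strip d).mem_nhds (ofReal_mem_strip hd t))).2 hg

lemma tendsto_integral_dslope_vertical (hc : 0 < c) (hcd : c < d)
    (hg : DifferentiableOn ℂ g (strip d)) (t : ℝ) {l : Filter ℝ}
    (hl : Tendsto (fun R : ℝ => |R - t|) l atTop)
    (hv : Tendsto (fun R : ℝ => ∫ y in -c..c, ‖g (R + Complex.I * y)‖) l (𝓝 0)) :
    Tendsto (fun R : ℝ => ∫ y in -c..c, dslope g t (R + y * Complex.I)) l (𝓝 0) := by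
  have hlim : Tendsto (fun R : ℝ => |R - t|⁻¹ *
      ((∫ y in -c..c, ‖g (R + Complex.I * y)‖) + 2 * c * ‖g t‖)) l (𝓝 0) := by
    simpa using (tendsto_inv_atTop_zero.comp hl).mul (hv.add_const (2 * c * ‖g t‖))
  refine squeeze_zero_norm' ?_ hlim
  filter_upwards [hl.eventually_gt_atTop 0] with R hR
  have hRt : R ≠ t := sub_ne_zero.1 (abs_pos.1 hR)
  have hcont : ContinuousOn (fun y : ℝ => g (R + Complex.I * y)) (uIcc (-c) c) := by
    refine hg.continuousOn.comp (by fun_prop) fun y hy => add_I_mul_mem_strip ?_ R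
    rw [uIcc_of_le (by linarith)] at hy
    exact (abs_le.2 hy).trans_lt hcd
  have hint : IntervalIntegrable (fun y : ℝ => ‖g (R + Complex.I * y)‖) volume (-c) c :=
    hcont.norm.intervalIntegrable
  calc _ ≤ ∫ y in -c..c, |R - t|⁻¹ * (‖g (R + Complex.I * y)‖ + ‖g t‖) :=
        intervalIntegral.norm_integral_le_of_norm_le (by linarith)
          (ae_of_all _ fun y _ => norm_dslope_le hRt y)
          ((hint.add intervalIntegrable_const).const_mul _)
    _ = _ := by
        rw [intervalIntegral.integral_const_mul,
          intervalIntegral.integral_add hint intervalIntegrable_const,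
          intervalIntegral.integral_const, smul_eq_mul]
        ring

lemma le_norm_line_sub (hc : 0 < c) (s t : ℝ) :
    c ≤ ‖(s + Complex.I * c : ℂ) - t‖ ∧ c ≤ ‖(s - Complex.I * c : ℂ) - t‖ := by
  constructor
  · simpa [abs_of_pos hc] using Complex.abs_im_le_norm ((s + Complex.I * c : ℂ) - t)
  · simpa [abs_of_pos hc] using Complex.abs_im_le_norm ((s - Complex.I * c : ℂ) - t)

lemma line_sub_ne_zero (hc : 0 < c) (s t : ℝ) :
    (s + Complex.I * c : ℂ) - t ≠ 0 ∧ (s - Complex.I * c : ℂ) - t ≠ 0 := by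
  have := le_norm_line_sub hc s t
  exact ⟨norm_pos_iff.1 (hc.trans_le this.1), norm_pos_iff.1 (hc.trans_le this.2)⟩

lemma integrable_mul_inv_line (hc : 0 < c) (hp : Integrable fun s : ℝ => g (s + Complex.I * c))
    (hm : Integrable fun s : ℝ => g (s - Complex.I * c)) (t : ℝ) :
    Integrable fun s : ℝ => g (s - Complex.I * c) / (s - Complex.I * c - t) -
      g (s + Complex.I * c) / (s + Complex.I * c - t) := by
  simp_rw [div_eq_mul_inv]
  refine Integrable.sub ?_ ?_
  · refine hm.mul_bdd (c := c⁻¹) ?_ (ae_of_all _ fun s => ?_)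
    · exact (Continuous.inv₀ (by fun_prop)
        fun s => (line_sub_ne_zero hc s t).2).aestronglyMeasurable
    · rw [norm_inv]
      exact inv_anti₀ hc (le_norm_line_sub hc s t).2
  · refine hp.mul_bdd (c := c⁻¹) ?_ (ae_of_all _ fun s => ?_)
    · exact (Continuous.inv₀ (by fun_prop)
        fun s => (line_sub_ne_zero hc s t).1).aestronglyMeasurable
    · rw [norm_inv]
      exact inv_anti₀ hc (le_norm_line_sub hc s t).1

/-- Cauchy's integral formula on the strip of half-width `c`. -/
lemma integral_cauchy_strip (hc : 0 < c) (hcd : c < d)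
    (hg : DifferentiableOn ℂ g (strip d))
    (hp : Integrable fun s : ℝ => g (s + Complex.I * c))
    (hm : Integrable fun s : ℝ => g (s - Complex.I * c))
    (htop : Tendsto (fun R : ℝ => ∫ y in -c..c, ‖g (R + Complex.I * y)‖) atTop (𝓝 0))
    (hbot : Tendsto (fun R : ℝ => ∫ y in -c..c, ‖g (R + Complex.I * y)‖) atBot (𝓝 0)) (t : ℝ) :
    ∫ s : ℝ, (g (s - Complex.I * c) / (s - Complex.I * c - t) -
      g (s + Complex.I * c) / (s + Complex.I * c - t)) = 2 * Real.pi * Complex.I * g t := by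
  -- The difference quotient of `g` at `t` is holomorphic across `t`, so its rectangle integrals
  -- vanish and no residue is needed. The subtracted term g(t)/(ζ - t), differenced between the two
  -- lines, is 2ic g(t)/((s - t)² + c²) (the function in `hP`), with integral 2πi g(t).
  have hd : 0 < d := hc.trans hcd
  have hF := differentiableOn_dslope_strip hd hg t
  have hH := integrable_mul_inv_line hc hp hm t
  have hP : Integrable fun s : ℝ =>
      g t * (2 * c * Complex.I) * ((((s - t) ^ 2 + c ^ 2)⁻¹ : ℝ) : ℂ) :=
    (integrable_poisson hc t).ofReal.const_mul _
  have hlim := intervalIntegral_tendsto_integral (hH.sub hP)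
    tendsto_neg_atTop_atBot tendsto_id
  have hvt := tendsto_integral_dslope_vertical hc hcd hg t
    (tendsto_abs_atTop_atTop.comp (tendsto_atTop_add_const_right _ (-t) tendsto_id)) htop
  have hvb := (tendsto_integral_dslope_vertical hc hcd hg t
    (tendsto_abs_atBot_atTop.comp (tendsto_atBot_add_const_right _ (-t) tendsto_id)) hbot).comp
    tendsto_neg_atTop_atBot
  have hv0 := (hvb.sub hvt).const_mul Complex.I
  rw [sub_zero, mul_zero] at hv0
  have hsub : ∀ s : ℝ, dslope g t (s + -c * Complex.I) - dslope g t (s + c * Complex.I) =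
      (g (s - Complex.I * c) / (s - Complex.I * c - t) -
      g (s + Complex.I * c) / (s + Complex.I * c - t)) -
      g t * (2 * c * Complex.I) * ((((s - t) ^ 2 + c ^ 2)⁻¹ : ℝ) : ℂ) := fun s => by
    obtain ⟨h1, h2⟩ := line_sub_ne_zero hc s t
    rw [show (s + -c * Complex.I : ℂ) = s - Complex.I * c by ring,
      show (s + c * Complex.I : ℂ) = s + Complex.I * c by ring,
      dslope_of_ne _ (sub_ne_zero.1 h1), dslope_of_ne _ (sub_ne_zero.1 h2),
      slope_def_field, slope_def_field]
    have h3 : ((((s - t) ^ 2 + c ^ 2)⁻¹ : ℝ) : ℂ) =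
        ((s + Complex.I * c - t) * (s - Complex.I * c - t))⁻¹ := by
      push_cast
      congr 1
      linear_combination (c : ℂ) ^ 2 * Complex.I_sq
    rw [h3]
    field_simp
    ring
  have hcontF : ∀ b : ℝ, |b| < d → Continuous fun s : ℝ => dslope g t (s + b * Complex.I) :=
    fun b hb => hF.continuousOn.comp_continuous (by fun_prop) fun s => by
      rw [mul_comm]; exact add_I_mul_mem_strip hb s
  have hcabs : |c| < d := by rwa [abs_of_pos hc]
  have heq : ∀ R : ℝ, 0 < R → (∫ s in -R..R, ((g (s - Complex.I * c) / (s - Complex.I * c - t) -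
      g (s + Complex.I * c) / (s + Complex.I * c - t)) -
      g t * (2 * c * Complex.I) * ((((s - t) ^ 2 + c ^ 2)⁻¹ : ℝ) : ℂ))) =
      Complex.I * ((∫ y in -c..c, dslope g t ((-R : ℝ) + y * Complex.I)) -
        ∫ y in -c..c, dslope g t (R + y * Complex.I)) := fun R hR => by
    have hrect := Complex.integral_boundary_rect_eq_zero_of_differentiableOn (dslope g t)
      ⟨-R, -c⟩ ⟨R, c⟩ (hF.mono fun ζ hζ => by
        have := hζ.2
        rw [mem_preimage, uIcc_of_le (by simp only; linarith)] at this
        exact (abs_le.2 this).trans_lt hcd)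
    simp only [smul_eq_mul] at hrect
    simp_rw [← hsub]
    have h1 := hcontF (-c) (by rwa [abs_neg])
    push_cast at h1
    rw [intervalIntegral.integral_sub (h1.intervalIntegrable _ _)
      ((hcontF c hcabs).intervalIntegrable _ _)]
    push_cast at hrect ⊢
    linear_combination hrect
  have hlim' : Tendsto (fun R : ℝ => Complex.I *
      ((∫ y in -c..c, dslope g t ((-R : ℝ) + y * Complex.I)) -
        ∫ y in -c..c, dslope g t (R + y * Complex.I))) atTop _ :=
    hlim.congr' ((eventually_gt_atTop 0).mono heq)
  have hval := tendsto_nhds_unique hlim' hv0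
  rw [integral_sub' hH hP, integral_const_mul, integral_complex_ofReal, integral_poisson hc] at hval
  rw [sub_eq_zero.1 hval]
  have : (c : ℂ) ≠ 0 := by exact_mod_cast hc.ne'
  push_cast
  field_simp

end

/-! ### Integrability on the real line and summability at the nodes -/

section

variable {f : ℂ → ℂ} {c d h : ℝ}

lemma tendsto_vertical_of_verticalIntegral (hf : AnalyticOnNhd ℂ f (strip d)) (hc : 0 < c)
    (hcd : c < d) {l : Filter ℝ} (hl : Tendsto (verticalIntegral f d) l (𝓝 0)) :
    Tendsto (fun R : ℝ => ∫ y in -c..c, ‖f (R + Complex.I * y)‖) l (𝓝 0) := by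
  have h1 := (ENNReal.tendsto_toReal ENNReal.zero_ne_top).comp hl
  refine squeeze_zero' (Eventually.of_forall fun R =>
    intervalIntegral.integral_nonneg (by linarith) fun y _ => norm_nonneg _) ?_ h1
  filter_upwards [hl.eventually (gt_mem_nhds ENNReal.zero_lt_top)] with R hR
  have hcont : ContinuousOn (fun y : ℝ => f (R + Complex.I * y)) (Icc (-c) c) :=
    hf.continuousOn.comp (by fun_prop) fun y hy =>
      add_I_mul_mem_strip ((abs_le.2 hy).trans_lt hcd) R
  rw [intervalIntegral.integral_of_le (by linarith), integral_norm_eq_lintegral_enorm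
    ((hcont.mono Ioc_subset_Icc_self).aestronglyMeasurable measurableSet_Ioc)]
  refine ENNReal.toReal_mono hR.ne (lintegral_mono_set fun y hy => ?_)
  exact ⟨by linarith [hy.1], by linarith [hy.2]⟩

lemma continuous_line (hf : AnalyticOnNhd ℂ f (strip d)) (hc : |c| < d) :
    (Continuous fun s : ℝ => f (s + Complex.I * c)) ∧
      Continuous fun s : ℝ => f (s - Complex.I * c) :=
  ⟨hf.continuousOn.comp_continuous (by fun_prop) fun s => add_I_mul_mem_strip hc s,
    hf.continuousOn.comp_continuous (by fun_prop) fun s => sub_I_mul_mem_strip hc s⟩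

lemma integrable_line (hf : AnalyticOnNhd ℂ f (strip d)) (hc : |c| < d)
    (hfin : lineIntegral f c ≠ ∞) :
    (Integrable fun s : ℝ => f (s + Complex.I * c)) ∧
      Integrable fun s : ℝ => f (s - Complex.I * c) := by
  obtain ⟨h1, h2⟩ := continuous_line hf hc
  refine ⟨⟨h1.aestronglyMeasurable, ?_⟩, ⟨h2.aestronglyMeasurable, ?_⟩⟩
  · exact (lintegral_mono fun s => le_self_add).trans_lt hfin.lt_top
  · exact (lintegral_mono fun s => le_add_self).trans_lt hfin.lt_top

lemma norm_exp_neg_sq_le {ζ : ℂ} (w : ℝ) :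
    ‖Complex.exp (-(ζ - w) ^ 2)‖ ≤ Real.exp (ζ.im ^ 2) * (1 + (ζ.re - w) ^ 2)⁻¹ := by
  have e : (-(ζ - w) ^ 2).re = ζ.im ^ 2 - (ζ.re - w) ^ 2 := by
    simp [pow_two]
  rw [Complex.norm_exp, e, sub_eq_add_neg, Real.exp_add, Real.exp_neg]
  gcongr
  linarith [Real.add_one_le_exp ((ζ.re - w) ^ 2)]

/-- The values on the real line are controlled by the lines `Im ζ = ± c`, with a kernel that decays
quadratically. -/
lemma enorm_le_lintegral_line (hf : InB f d) (hc : 0 < c) (hcd : c < d)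
    (hfin : lineIntegral f c ≠ ∞) (w : ℝ) :
    ‖f w‖ₑ ≤ ENNReal.ofReal (Real.exp (c ^ 2) / c) *
      ∫⁻ s : ℝ, (‖f (s + Complex.I * c)‖ₑ + ‖f (s - Complex.I * c)‖ₑ) *
        ENNReal.ofReal (1 + (s - w) ^ 2)⁻¹ := by
  have hcabs : |c| < d := by rwa [abs_of_pos hc]
  obtain ⟨hp, hm⟩ := integrable_line hf.analytic hcabs hfin
  -- The Gaussian equals 1 at `w`, so the value there is unchanged, while on the lines it supplies
  -- the decay that 1/(ζ - w) lacks.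
  set g : ℂ → ℂ := fun ζ => f ζ * Complex.exp (-(ζ - w) ^ 2) with hgdef
  have hg : DifferentiableOn ℂ g (strip d) := hf.analytic.differentiableOn.mul
    (Differentiable.differentiableOn (by fun_prop))
  have hmul_le : ∀ {ζ : ℂ}, |ζ.im| ≤ c →
      ‖g ζ‖ ≤ ‖f ζ‖ * (Real.exp (c ^ 2) * (1 + (ζ.re - w) ^ 2)⁻¹) := fun {ζ} hζ => by
    rw [hgdef, norm_mul]
    gcongr
    refine (norm_exp_neg_sq_le w).trans ?_
    gcongr ?_ * _
    exact Real.exp_le_exp.2 (sq_le_sq' (abs_le.1 hζ).1 (abs_le.1 hζ).2)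
  have hmul_le' : ∀ {ζ : ℂ}, |ζ.im| ≤ c → ‖g ζ‖ ≤ Real.exp (c ^ 2) * ‖f ζ‖ := fun {ζ} hζ => by
    refine (hmul_le hζ).trans ?_
    rw [mul_comm]
    gcongr
    exact mul_le_of_le_one_right (by positivity) (inv_le_one_of_one_le₀ (by
      linarith [sq_nonneg (ζ.re - w)]))
  have hgan : AnalyticOnNhd ℂ g (strip d) := hg.analyticOnNhd (isOpen_strip d)
  obtain ⟨gp, gm⟩ := continuous_line hgan hcabs
  have hgp : Integrable fun s : ℝ => g (s + Complex.I * c) :=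
    (hp.norm.const_mul (Real.exp (c ^ 2))).mono' gp.aestronglyMeasurable
      (ae_of_all _ fun s => hmul_le' (by simp [abs_of_pos hc]))
  have hgm : Integrable fun s : ℝ => g (s - Complex.I * c) :=
    (hm.norm.const_mul (Real.exp (c ^ 2))).mono' gm.aestronglyMeasurable
      (ae_of_all _ fun s => hmul_le' (by simp [abs_of_pos hc]))
  have hvert : ∀ {l : Filter ℝ}, Tendsto (verticalIntegral f d) l (𝓝 0) →
      Tendsto (fun R : ℝ => ∫ y in -c..c, ‖g (R + Complex.I * y)‖) l (𝓝 0) := fun {l} hl => by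
    have h0 := (tendsto_vertical_of_verticalIntegral hf.analytic hc hcd hl).const_mul
      (Real.exp (c ^ 2))
    rw [mul_zero] at h0
    refine squeeze_zero (fun R => intervalIntegral.integral_nonneg (by linarith)
      fun y _ => norm_nonneg _) (fun R => ?_) h0
    rw [← intervalIntegral.integral_const_mul]
    have hcont : ∀ {k : ℂ → ℂ}, AnalyticOnNhd ℂ k (strip d) →
        ContinuousOn (fun y : ℝ => ‖k (R + Complex.I * y)‖) (uIcc (-c) c) := fun hk =>
      (hk.continuousOn.comp (by fun_prop) fun y hy => by
        rw [uIcc_of_le (by linarith)] at hy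
        exact add_I_mul_mem_strip ((abs_le.2 hy).trans_lt hcd) R).norm
    refine intervalIntegral.integral_mono_on (by linarith) (hcont hgan).intervalIntegrable
      ((hcont hf.analytic).intervalIntegrable.const_mul _) fun y hy => hmul_le' ?_
    simpa using abs_le.2 hy
  have key := integral_cauchy_strip hc hcd hg hgp hgm (hvert hf.vertical_atTop)
    (hvert hf.vertical_atBot) w
  have hgw : g w = f w := by simp [hgdef]
  have hpi : 1 ≤ ‖(2 * Real.pi * Complex.I : ℂ)‖ := by
    simp only [norm_mul, Complex.norm_ofNat, Complex.norm_real, Complex.norm_I, mul_one,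
      Real.norm_of_nonneg Real.pi_pos.le]
    linarith [Real.pi_gt_three]
  calc ‖f w‖ₑ ≤ ‖2 * Real.pi * Complex.I * g w‖ₑ := by
        rw [hgw]
        refine enorm_le_iff_norm_le.2 ?_
        rw [norm_mul]
        exact le_mul_of_one_le_left (norm_nonneg _) hpi
    _ ≤ _ := by
        rw [← key]
        refine (enorm_integral_le_lintegral_enorm _).trans ?_
        rw [← lintegral_const_mul' _ _ ENNReal.ofReal_ne_top]
        refine lintegral_mono fun s => ?_
        obtain ⟨h1, h2⟩ := le_norm_line_sub hc s w
        rw [← ofReal_norm, ← ofReal_norm, ← ofReal_norm,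
          ← ENNReal.ofReal_add (norm_nonneg _) (norm_nonneg _),
          ← ENNReal.ofReal_mul (by positivity), ← ENNReal.ofReal_mul (by positivity)]
        refine ENNReal.ofReal_le_ofReal ((norm_sub_le _ _).trans ?_)
        rw [norm_div, norm_div]
        have b1 := hmul_le (ζ := s + Complex.I * c) (by simp [abs_of_pos hc])
        have b2 := hmul_le (ζ := s - Complex.I * c) (by simp [abs_of_pos hc])
        simp only [Complex.add_re, Complex.sub_re, Complex.ofReal_re, Complex.mul_re, Complex.I_re,
          zero_mul, Complex.I_im, Complex.ofReal_im, mul_zero, sub_zero, add_zero] at b1 b2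
        calc _ ≤ ‖f (s - Complex.I * c)‖ * (Real.exp (c ^ 2) * (1 + (s - w) ^ 2)⁻¹) / c +
              ‖f (s + Complex.I * c)‖ * (Real.exp (c ^ 2) * (1 + (s - w) ^ 2)⁻¹) / c := by
              gcongr
          _ = _ := by ring

/-- Tonelli, then the uniform bound on the periodized kernel. -/
lemma tsum_lintegral_lattice_ne_top {M : ℝ → ℝ≥0∞} (hM : Measurable M) (hfin : ∫⁻ s, M s ≠ ∞)
    (hh : 0 < h) :
    ∑' j : ℤ, ∫⁻ s : ℝ, M s * ENNReal.ofReal (1 + (s - j * h) ^ 2)⁻¹ ≠ ∞ := by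
  obtain ⟨C, hC, hle⟩ := exists_tsum_lattice_le hh
  rw [← lintegral_tsum fun j => by fun_prop]
  refine ne_top_of_le_ne_top (ENNReal.mul_ne_top hfin hC) ?_
  rw [← lintegral_mul_const' _ _ hC]
  refine lintegral_mono fun s => ?_
  rw [ENNReal.tsum_mul_left]
  gcongr
  exact hle s

lemma measurable_enorm_line (hf : AnalyticOnNhd ℂ f (strip d)) (hc : |c| < d) :
    Measurable fun s : ℝ => ‖f (s + Complex.I * c)‖ₑ + ‖f (s - Complex.I * c)‖ₑ := by
  obtain ⟨h1, h2⟩ := continuous_line hf hc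
  exact h1.measurable.enorm.add h2.measurable.enorm

lemma summable_norm_lattice (hf : InB f d) (hc : 0 < c) (hcd : c < d)
    (hfin : lineIntegral f c ≠ ∞) (hh : 0 < h) :
    Summable fun j : ℤ => ‖f ((j * h : ℝ) : ℂ)‖ := by
  have hM := measurable_enorm_line hf.analytic (c := c) (by rwa [abs_of_pos hc])
  have h1 := tsum_lintegral_lattice_ne_top hM hfin hh
  have h2 : ∑' j : ℤ, ‖f ((j * h : ℝ) : ℂ)‖ₑ ≠ ∞ := by
    refine ne_top_of_le_ne_top (ENNReal.mul_ne_top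
      (ENNReal.ofReal_ne_top (r := Real.exp (c ^ 2) / c)) h1) ?_
    rw [← ENNReal.tsum_mul_left]
    exact ENNReal.tsum_le_tsum fun j : ℤ => enorm_le_lintegral_line hf hc hcd hfin (j * h)
  simpa using ENNReal.summable_toReal h2

lemma lintegral_lintegral_kernel {M : ℝ → ℝ≥0∞} (hM : Measurable M) :
    ∫⁻ t : ℝ, ∫⁻ s : ℝ, M s * ENNReal.ofReal (1 + (s - t) ^ 2)⁻¹ =
      (∫⁻ s, M s) * ENNReal.ofReal Real.pi := by
  rw [lintegral_lintegral_swap (by fun_prop), ← lintegral_mul_const' _ _ ENNReal.ofReal_ne_top]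
  refine lintegral_congr fun s => ?_
  rw [lintegral_const_mul _ (by fun_prop),
    lintegral_sub_left_eq_self (fun u : ℝ => ENNReal.ofReal (1 + u ^ 2)⁻¹) s,
    ← ofReal_integral_eq_lintegral_ofReal integrable_inv_one_add_sq
      (ae_of_all _ fun t => by positivity), integral_univ_inv_one_add_sq]

lemma integrable_real_line (hf : InB f d) (hc : 0 < c) (hcd : c < d)
    (hfin : lineIntegral f c ≠ ∞) : Integrable fun t : ℝ => f t := by
  have hM := measurable_enorm_line hf.analytic (c := c) (by rwa [abs_of_pos hc])
  refine ⟨(hf.analytic.continuousOn.comp_continuous Complex.continuous_ofReal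
    fun t => ofReal_mem_strip (hc.trans hcd) t).aestronglyMeasurable, ?_⟩
  refine (lintegral_mono fun t => enorm_le_lintegral_line hf hc hcd hfin t).trans_lt ?_
  rw [lintegral_const_mul' _ _ ENNReal.ofReal_ne_top, lintegral_lintegral_kernel hM]
  exact ENNReal.mul_lt_top ENNReal.ofReal_lt_top
    (ENNReal.mul_lt_top hfin.lt_top ENNReal.ofReal_lt_top)

end

/-! ### Estimates for the weighted Cauchy transforms -/

section

variable {g ζ : ℝ → ℂ} {c h : ℝ}

lemma sub_ofReal_ne_zero (hc : 0 < c) (hζ : ∀ s, |(ζ s).im| = c) (s t : ℝ) : ζ s - t ≠ 0 := by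
  have h1 := abs_im_le_norm_sub_ofReal (ζ s) t
  rw [hζ] at h1
  exact norm_pos_iff.1 (hc.trans_le h1)

lemma integrable_div_sub (hc : 0 < c) (hζc : Continuous ζ) (hζ : ∀ s, |(ζ s).im| = c)
    (hg : Integrable g) (t : ℝ) : Integrable fun s => g s / (ζ s - t) := by
  simp_rw [div_eq_mul_inv]
  refine hg.mul_bdd (c := c⁻¹) ?_ (ae_of_all _ fun s => ?_)
  · exact (Continuous.inv₀ (by fun_prop) fun s => sub_ofReal_ne_zero hc hζ s t).aestronglyMeasurable
  · rw [norm_inv]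
    exact inv_anti₀ hc ((hζ s).symm.trans_le (abs_im_le_norm_sub_ofReal (ζ s) t))

lemma norm_sin_ofReal_le (t : ℝ) : ‖Complex.sin (Real.pi * t / h)‖ ≤ 1 := by
  have : Complex.sin (Real.pi * t / h) = (Real.sin (Real.pi * t / h) : ℂ) := by push_cast; rfl
  rw [this, Complex.norm_real]
  exact Real.abs_sin_le_one _

/-- Oscillation bound for a weighted Cauchy transform along a curve at distance `c` from `ℝ`. -/
lemma integral_sin_mul_cauchy (hh : 0 < h) (hc : 0 < c) (hζc : Continuous ζ)
    (hζ : ∀ s, |(ζ s).im| = c) (hg : Integrable g) {a x : ℝ} (hax : a ≤ x) :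
    IntervalIntegrable (fun t : ℝ => Complex.sin (Real.pi * t / h) * ∫ s, g s / (ζ s - t))
      volume a x ∧
    ‖∫ t in a..x, Complex.sin (Real.pi * t / h) * ∫ s, g s / (ζ s - t)‖ ≤
      4 * h / c * ∫ s, ‖g s‖ := by
  have hcont : Continuous fun p : ℝ × ℝ =>
      Complex.sin (Real.pi * p.1 / h) / (ζ p.2 - p.1) :=
    Continuous.div (by fun_prop) (by fun_prop) fun p => sub_ofReal_ne_zero hc hζ _ _
  have hint : Integrable (Function.uncurry fun t s : ℝ =>
      g s * (Complex.sin (Real.pi * t / h) / (ζ s - t)))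
      ((volume.restrict (Ioc a x)).prod volume) := by
    refine (hg.comp_snd (volume.restrict (Ioc a x))).mul_bdd (c := 1 / c)
      hcont.aestronglyMeasurable (ae_of_all _ fun p => ?_)
    rw [norm_div]
    exact div_le_div₀ zero_le_one (norm_sin_ofReal_le _) hc
      ((hζ p.2).symm.trans_le (abs_im_le_norm_sub_ofReal _ _))
  have hrw : ∀ t : ℝ, Complex.sin (Real.pi * t / h) * ∫ s, g s / (ζ s - t) =
      ∫ s, g s * (Complex.sin (Real.pi * t / h) / (ζ s - t)) := fun t => by
    rw [← integral_const_mul]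
    congr 1
    ext s
    ring
  simp_rw [hrw]
  refine ⟨?_, ?_⟩
  · rw [intervalIntegrable_iff_integrableOn_Ioc_of_le hax]
    exact hint.integral_prod_left
  -- After Fubini the `t`-integral is innermost, where the oscillation bound holds uniformly in `s`.
  · rw [intervalIntegral.integral_of_le hax, integral_integral_swap hint, ← integral_const_mul]
    refine norm_integral_le_of_norm_le (hg.norm.const_mul _) (ae_of_all _ fun s => ?_)
    rw [integral_const_mul, norm_mul, mul_comm]
    gcongr
    rw [← intervalIntegral.integral_of_le hax]
    exact norm_integral_sin_div_le hh hc (ζ s) (hζ s) hax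

lemma sinh_le_norm_sin_div (hh : 0 < h) (hζ : ∀ s, |(ζ s).im| = c) (s : ℝ) :
    Real.sinh (Real.pi * c / h) ≤ ‖Complex.sin (Real.pi * ζ s / h)‖ := by
  refine sinh_le_norm_sin _ ?_
  have : (Real.pi * ζ s / h : ℂ) = ((Real.pi / h : ℝ) : ℂ) * ζ s := by push_cast; ring
  rw [this, Complex.im_ofReal_mul, abs_mul, hζ, abs_of_pos (div_pos Real.pi_pos hh)]
  ring

lemma integrable_div_sin (hh : 0 < h) (hc : 0 < c) (hζc : Continuous ζ) (hζ : ∀ s, |(ζ s).im| = c)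
    (hg : Integrable g) :
    (Integrable fun s => g s / Complex.sin (Real.pi * ζ s / h)) ∧
      ∫ s, ‖g s / Complex.sin (Real.pi * ζ s / h)‖ ≤
        (Real.sinh (Real.pi * c / h))⁻¹ * ∫ s, ‖g s‖ := by
  have hpos : 0 < Real.sinh (Real.pi * c / h) := by
    rw [Real.sinh_pos_iff]
    have := Real.pi_pos
    positivity
  have hb := fun s => inv_anti₀ hpos (sinh_le_norm_sin_div hh hζ s)
  have h1 : Integrable fun s => g s / Complex.sin (Real.pi * ζ s / h) := by
    simp_rw [div_eq_mul_inv (g _)]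
    refine hg.mul_bdd (c := (Real.sinh (Real.pi * c / h))⁻¹) ?_ (ae_of_all _ fun s => ?_)
    · exact (Continuous.inv₀ (by fun_prop) fun s => norm_pos_iff.1
        (hpos.trans_le (sinh_le_norm_sin_div hh hζ s))).aestronglyMeasurable
    · rw [norm_inv]
      exact hb s
  refine ⟨h1, ?_⟩
  rw [← integral_const_mul]
  refine integral_mono h1.norm (hg.norm.const_mul _) fun s => ?_
  simp only [norm_div]
  rw [div_eq_inv_mul]
  exact mul_le_mul_of_nonneg_right (hb s) (norm_nonneg _)

end

/-! ### The pointwise interpolation error -/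

section

variable {f : ℂ → ℂ} {c d h : ℝ}

lemma abs_im_line (hc : 0 < c) :
    (∀ s : ℝ, |(s + Complex.I * c : ℂ).im| = c) ∧ ∀ s : ℝ, |(s - Complex.I * c : ℂ).im| = c := by
  simp [abs_of_pos hc]

/-- Both factors are O(1/|j|), so their product is dominated by the sum of their squares. The form
`j * 1` matches `exists_tsum_lattice_le` with spacing 1. -/
lemma abs_nsinc_mul_le {ζ : ℂ} (hc : 0 < c) (hζ : |ζ.im| = c) (hh : 0 < h) (t : ℝ) (j : ℤ) :
    |nsinc ((t - j * h) / h)| * ‖ζ - j * h‖⁻¹ ≤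
      2 * (1 + (t / h - j * 1) ^ 2)⁻¹ + (1 + (c ^ 2)⁻¹) * (1 + (ζ.re - j * h) ^ 2)⁻¹ := by
  have h1 := nsinc_sq_le ((t - j * h) / h)
  have e : (t - j * h) / h = t / h - j * 1 := by field_simp
  have h2 := norm_sub_ofReal_sq ζ (j * h)
  push_cast at h2
  have hc2 : 0 < c ^ 2 := by positivity
  have h3 : (‖ζ - j * h‖⁻¹) ^ 2 ≤ (1 + (c ^ 2)⁻¹) * (1 + (ζ.re - j * h) ^ 2)⁻¹ := by
    rw [inv_pow, h2, hζ, ← div_eq_mul_inv, ← one_div, div_le_div_iff₀ (by positivity) (by positivity)]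
    have : (c ^ 2)⁻¹ * c ^ 2 = 1 := inv_mul_cancel₀ hc2.ne'
    nlinarith [mul_nonneg (inv_nonneg.2 hc2.le) (sq_nonneg (j * h - ζ.re))]
  rw [e] at h1 ⊢
  rw [← sq_abs] at h1
  nlinarith [sq_nonneg (|nsinc (t / h - j * 1)| - ‖ζ - j * h‖⁻¹), sq_nonneg (‖ζ - j * h‖⁻¹),
    sq_nonneg (nsinc (t / h - j * 1)), sq_abs (nsinc (t / h - j * 1))]

/-- The pointwise error of sinc interpolation, as a contour integral over `Im ζ = ± c`. -/
lemma interpolation_error_eq (hf : InB f d) (hc : 0 < c) (hcd : c < d)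
    (hfin : lineIntegral f c ≠ ∞) (hh : 0 < h) (t : ℝ) :
    2 * Real.pi * Complex.I *
      (f t - ∑' j : ℤ, f ((j * h : ℝ) : ℂ) * (nsinc ((t - j * h) / h) : ℂ)) =
    Complex.sin (Real.pi * t / h) *
        (∫ s : ℝ, f (s - Complex.I * c) / Complex.sin (Real.pi * (s - Complex.I * c) / h) /
          (s - Complex.I * c - t)) -
      Complex.sin (Real.pi * t / h) *
        (∫ s : ℝ, f (s + Complex.I * c) / Complex.sin (Real.pi * (s + Complex.I * c) / h) /
          (s + Complex.I * c - t)) := by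
  have hcabs : |c| < d := by rwa [abs_of_pos hc]
  obtain ⟨hp, hm⟩ := integrable_line hf.analytic hcabs hfin
  obtain ⟨ip, im⟩ := abs_im_line hc
  have hcauchy := integral_cauchy_strip hc hcd hf.analytic.differentiableOn hp hm
    (tendsto_vertical_of_verticalIntegral hf.analytic hc hcd hf.vertical_atTop)
    (tendsto_vertical_of_verticalIntegral hf.analytic hc hcd hf.vertical_atBot)
  have hHint := integrable_mul_inv_line hc hp hm
  have hM := measurable_enorm_line hf.analytic hcabs
  set M : ℝ → ℝ≥0∞ := fun s => ‖f (s + Complex.I * c)‖ₑ + ‖f (s - Complex.I * c)‖ₑ with hMdef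
  set H : ℝ → ℝ → ℂ := fun t s => f (s - Complex.I * c) / (s - Complex.I * c - t) -
      f (s + Complex.I * c) / (s + Complex.I * c - t) with hHdef
  set S := Complex.sin (Real.pi * t / h) with hS
  have hterm : ∀ (j : ℤ) (s : ℝ), ‖(nsinc ((t - j * h) / h) : ℂ) * H ((j * h : ℝ)) s‖ₑ ≤
      M s * (ENNReal.ofReal 2 * ENNReal.ofReal (1 + (t / h - j * 1) ^ 2)⁻¹ +
        ENNReal.ofReal (1 + (c ^ 2)⁻¹) * ENNReal.ofReal (1 + (s - j * h) ^ 2)⁻¹) := fun j s => by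
    have b1 := abs_nsinc_mul_le hc (ip s) hh t j
    have b2 := abs_nsinc_mul_le hc (im s) hh t j
    simp only [Complex.add_re, Complex.sub_re, Complex.ofReal_re, Complex.mul_re, Complex.I_re,
      zero_mul, Complex.I_im, Complex.ofReal_im, mul_zero, sub_zero, add_zero] at b1 b2
    rw [hMdef]
    simp only
    rw [← ofReal_norm, ← ofReal_norm, ← ofReal_norm,
      ← ENNReal.ofReal_add (norm_nonneg _) (norm_nonneg _),
      ← ENNReal.ofReal_mul (by positivity), ← ENNReal.ofReal_mul (by positivity),
      ← ENNReal.ofReal_add (by positivity) (by positivity), ← ENNReal.ofReal_mul (by positivity)]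
    refine ENNReal.ofReal_le_ofReal ?_
    rw [norm_mul, Complex.norm_real, Real.norm_eq_abs, add_mul]
    calc _ ≤ |nsinc ((t - j * h) / h)| * (‖f (s - Complex.I * c)‖ / ‖(s - Complex.I * c : ℂ) - j * h‖
          + ‖f (s + Complex.I * c)‖ / ‖(s + Complex.I * c : ℂ) - j * h‖) := by
          gcongr
          refine (norm_sub_le _ _).trans_eq ?_
          rw [norm_div, norm_div]
          push_cast
          rfl
      _ = ‖f (s + Complex.I * c)‖ * (|nsinc ((t - j * h) / h)| * ‖(s + Complex.I * c : ℂ) - j * h‖⁻¹)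
          + ‖f (s - Complex.I * c)‖ *
            (|nsinc ((t - j * h) / h)| * ‖(s - Complex.I * c : ℂ) - j * h‖⁻¹) := by ring
      _ ≤ _ := by gcongr
  have hsum : ∑' j : ℤ, ∫⁻ s, ‖(nsinc ((t - j * h) / h) : ℂ) * H ((j * h : ℝ)) s‖ₑ ≠ ∞ := by
    obtain ⟨C, hC, hle⟩ := exists_tsum_lattice_le one_pos
    refine ne_top_of_le_ne_top ?_ (ENNReal.tsum_le_tsum fun j => lintegral_mono (hterm j))
    have hM0 : ∀ (K : ℝ≥0∞), ∫⁻ s, M s * K = (∫⁻ s, M s) * K := fun K =>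
      lintegral_mul_const _ hM
    simp_rw [mul_add]
    have e : ∀ j : ℤ, (∫⁻ s, (M s * (ENNReal.ofReal 2 *
        ENNReal.ofReal (1 + (t / h - j * 1) ^ 2)⁻¹) +
        M s * (ENNReal.ofReal (1 + (c ^ 2)⁻¹) * ENNReal.ofReal (1 + (s - j * h) ^ 2)⁻¹))) =
        ((∫⁻ s, M s) * ENNReal.ofReal 2) * ENNReal.ofReal (1 + (t / h - j * 1) ^ 2)⁻¹ +
        ENNReal.ofReal (1 + (c ^ 2)⁻¹) *
          ∫⁻ s, M s * ENNReal.ofReal (1 + (s - j * h) ^ 2)⁻¹ := fun j => by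
      rw [lintegral_add_left (hM.mul_const _), hM0, ← lintegral_const_mul' _ _ ENNReal.ofReal_ne_top]
      rw [mul_assoc (∫⁻ s, M s)]
      congr 1
      exact lintegral_congr fun s => mul_left_comm _ _ _
    simp_rw [e]
    rw [ENNReal.tsum_add, ENNReal.tsum_mul_left, ENNReal.tsum_mul_left]
    refine ENNReal.add_ne_top.2 ⟨ENNReal.mul_ne_top
      (ENNReal.mul_ne_top hfin ENNReal.ofReal_ne_top) (ne_top_of_le_ne_top hC (hle _)),
      ENNReal.mul_ne_top ENNReal.ofReal_ne_top (tsum_lintegral_lattice_ne_top hM hfin hh)⟩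
  -- The two sides are evaluated differently: on the left the kernel is summed in closed form
  -- (`hpt`), on the right Cauchy's formula at each node returns 2πi f(jh).
  have hswap : ∫ s, ∑' j : ℤ, (nsinc ((t - j * h) / h) : ℂ) * H ((j * h : ℝ)) s =
      ∑' j : ℤ, ∫ s, (nsinc ((t - j * h) / h) : ℂ) * H ((j * h : ℝ)) s := integral_tsum (fun j : ℤ =>
    ((hHint (j * h)).const_mul (nsinc ((t - j * h) / h) : ℂ)).aestronglyMeasurable) hsum
  have hpt : ∀ s : ℝ, ∑' j : ℤ, (nsinc ((t - j * h) / h) : ℂ) * H ((j * h : ℝ)) s =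
      H t s - (S * (f (s - Complex.I * c) / Complex.sin (Real.pi * (s - Complex.I * c) / h) /
          (s - Complex.I * c - t)) -
        S * (f (s + Complex.I * c) / Complex.sin (Real.pi * (s + Complex.I * c) / h) /
          (s + Complex.I * c - t))) := fun s => by
    have him : ∀ {z : ℂ}, |z.im| = c → z.im ≠ 0 := fun {z} hz => abs_pos.1 (hz ▸ hc)
    have k1 := (hasSum_nsinc_div_sub hh t _ (him (im s))).mul_left (f (s - Complex.I * c))
    have k2 := (hasSum_nsinc_div_sub hh t _ (him (ip s))).mul_left (f (s + Complex.I * c))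
    have k3 : HasSum (fun j : ℤ => (nsinc ((t - j * h) / h) : ℂ) * H ((j * h : ℝ)) s) _ :=
      (k1.sub k2).congr_fun fun j => by
        simp only [hHdef]
        push_cast
        ring
    rw [k3.tsum_eq]
    simp only [hHdef]
    ring
  simp_rw [hpt] at hswap
  have i1 := (integrable_div_sub hc (by fun_prop) im
    (integrable_div_sin hh hc (by fun_prop) im hm).1 t).const_mul S
  have i2 := (integrable_div_sub hc (by fun_prop) ip
    (integrable_div_sin hh hc (by fun_prop) ip hp).1 t).const_mul S
  have i3 : Integrable fun s : ℝ =>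
      S * (f (s - Complex.I * c) / Complex.sin (Real.pi * (s - Complex.I * c) / h) /
          (s - Complex.I * c - t)) -
        S * (f (s + Complex.I * c) / Complex.sin (Real.pi * (s + Complex.I * c) / h) /
          (s + Complex.I * c - t)) := i1.sub i2
  have hHt : ∀ t : ℝ, ∫ s, H t s = 2 * Real.pi * Complex.I * f t := hcauchy
  have hHi : Integrable fun s => H t s := hHint t
  rw [integral_sub hHi i3, integral_sub i1 i2, integral_const_mul, integral_const_mul,
    hHt t] at hswap
  simp_rw [integral_const_mul, hHt] at hswap
  rw [mul_sub, ← tsum_mul_left]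
  have e2 : ∀ j : ℤ, (nsinc ((t - j * h) / h) : ℂ) *
      (2 * Real.pi * Complex.I * f ((j * h : ℝ) : ℂ)) =
      2 * Real.pi * Complex.I * (f ((j * h : ℝ) : ℂ) * (nsinc ((t - j * h) / h) : ℂ)) :=
    fun j => by ring
  simp_rw [e2] at hswap
  rw [← hswap]
  ring

end

/-! ### The integrated error and the limits a → -∞, c → d -/

section

variable {f : ℂ → ℂ} {c d h : ℝ}

lemma integral_interpolation_error (hf : InB f d) (hd : 0 < d)
    (hs : Summable fun j : ℤ => ‖f ((j * h : ℝ) : ℂ)‖) (a x : ℝ) :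
    ∫ t in a..x, (f (t : ℂ) - ∑' j : ℤ, f ((j * h : ℝ) : ℂ) * (nsinc ((t - j * h) / h) : ℂ)) =
      (∫ t in a..x, f (t : ℂ)) - ∑' j : ℤ, f ((j * h : ℝ) : ℂ) *
        ((∫ t in a..x, nsinc ((t - j * h) / h) : ℝ) : ℂ) := by
  have hcj : ∀ j : ℤ, Continuous fun t : ℝ =>
      f ((j * h : ℝ) : ℂ) * (nsinc ((t - j * h) / h) : ℂ) := fun j =>
    continuous_const.mul (Complex.continuous_ofReal.comp (continuous_nsinc.comp (by fun_prop)))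
  have hb : ∀ (j : ℤ) (t : ℝ), ‖f ((j * h : ℝ) : ℂ) * (nsinc ((t - j * h) / h) : ℂ)‖ ≤
      ‖f ((j * h : ℝ) : ℂ)‖ := fun j t => by
    rw [norm_mul, Complex.norm_real]
    exact mul_le_of_le_one_right (norm_nonneg _) (Real.abs_sinc_le_one _)
  have hct := continuous_tsum hcj hs hb
  have hcf : Continuous fun t : ℝ => f t := hf.analytic.continuousOn.comp_continuous
    Complex.continuous_ofReal fun t => ofReal_mem_strip hd t
  rw [intervalIntegral.integral_sub (hcf.intervalIntegrable _ _) (hct.intervalIntegrable _ _)]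
  have := intervalIntegral.hasSum_integral_of_dominated_convergence (a := a) (b := x)
    (μ := volume) (fun (j : ℤ) (_ : ℝ) => ‖f ((j * h : ℝ) : ℂ)‖)
    (fun j => (hcj j).aestronglyMeasurable) (fun j => ae_of_all _ fun t _ => hb j t)
    (ae_of_all _ fun t _ => hs) intervalIntegrable_const
    (ae_of_all _ fun t _ => (hs.of_norm_bounded fun j => hb j t).hasSum)
  rw [← this.tsum_eq]
  simp_rw [intervalIntegral.integral_const_mul, intervalIntegral.integral_ofReal]

/-- Uses 2 sinh u = e^u (1 - e^(-2u)) with u = πc/h. -/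
lemma inv_two_pi_sinh (hh : 0 < h) (hc : 0 < c) :
    (2 * Real.pi)⁻¹ * (4 * h / c * (Real.sinh (Real.pi * c / h))⁻¹) =
      4 * h * Real.exp (-Real.pi * c / h) /
        (Real.pi * c * (1 - Real.exp (-2 * Real.pi * c / h))) := by
  have hpi := Real.pi_pos
  have hu : 0 < Real.pi * c / h := by positivity
  have e1 : -Real.pi * c / h = -(Real.pi * c / h) := by ring
  have e2 : -2 * Real.pi * c / h = -(Real.pi * c / h) + -(Real.pi * c / h) := by ring
  rw [e1, e2, Real.exp_add, Real.sinh_eq, Real.exp_neg]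
  have hE := Real.one_lt_exp_iff.2 hu
  set E := Real.exp (Real.pi * c / h)
  have h1 : E - E⁻¹ ≠ 0 := (sub_pos.2 ((inv_lt_one_of_one_lt₀ hE).trans hE)).ne'
  have h0 : E ≠ 0 := by positivity
  have h3 : E ^ 2 - 1 ≠ 0 := by nlinarith
  have h4 : E - E⁻¹ = (E ^ 2 - 1) / E := by field_simp
  have h5 : 1 - E⁻¹ * E⁻¹ = (E ^ 2 - 1) / E ^ 2 := by field_simp
  rw [h4, h5]
  field_simp

lemma norm_integral_sub_tsum_le (hf : InB f d) (hc : 0 < c) (hcd : c < d)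
    (hfin : lineIntegral f c ≠ ∞) (hh : 0 < h) {a x : ℝ} (hax : a ≤ x) :
    ‖(∫ t in a..x, f (t : ℂ)) - ∑' j : ℤ, f ((j * h : ℝ) : ℂ) *
        ((∫ t in a..x, nsinc ((t - j * h) / h) : ℝ) : ℂ)‖ₑ ≤
      ENNReal.ofReal (4 * h * Real.exp (-Real.pi * c / h) /
        (Real.pi * c * (1 - Real.exp (-2 * Real.pi * c / h)))) * lineIntegral f c := by
  have hcabs : |c| < d := by rwa [abs_of_pos hc]
  obtain ⟨hp, hm⟩ := integrable_line hf.analytic hcabs hfin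
  obtain ⟨ip, im⟩ := abs_im_line hc
  obtain ⟨gp, np⟩ := integrable_div_sin hh hc (by fun_prop) ip hp
  obtain ⟨gm, nm⟩ := integrable_div_sin hh hc (by fun_prop) im hm
  obtain ⟨jp, bp⟩ := integral_sin_mul_cauchy hh hc (by fun_prop) ip gp hax
  obtain ⟨jm, bm⟩ := integral_sin_mul_cauchy hh hc (by fun_prop) im gm hax
  have hline : lineIntegral f c = ENNReal.ofReal
      ((∫ s : ℝ, ‖f (s + Complex.I * c)‖) + ∫ s : ℝ, ‖f (s - Complex.I * c)‖) := by
    rw [ENNReal.ofReal_add (by positivity) (by positivity), ofReal_integral_norm_eq_lintegral_enorm hp,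
      ofReal_integral_norm_eq_lintegral_enorm hm, lineIntegral,
      lintegral_add_left (continuous_line hf.analytic hcabs).1.measurable.enorm]
  rw [hline, ← inv_two_pi_sinh hh hc, ← ofReal_norm, ← ENNReal.ofReal_mul (by
    have := Real.pi_pos
    have : 0 ≤ Real.sinh (Real.pi * c / h) := Real.sinh_nonneg_iff.2 (by positivity)
    positivity)]
  refine ENNReal.ofReal_le_ofReal ?_
  rw [← integral_interpolation_error hf (hc.trans hcd)
    (summable_norm_lattice hf hc hcd hfin hh), mul_assoc, ← div_eq_inv_mul,
    le_div_iff₀ (by have := Real.pi_pos; positivity), mul_comm]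
  have hn : ‖(2 * Real.pi * Complex.I : ℂ)‖ = 2 * Real.pi := by
    simp [abs_of_pos Real.pi_pos]
  rw [← hn, ← norm_mul, ← intervalIntegral.integral_const_mul]
  simp_rw [interpolation_error_eq hf hc hcd hfin hh]
  rw [intervalIntegral.integral_sub jm jp]
  refine (norm_sub_le _ _).trans ((add_le_add bm bp).trans ?_)
  rw [← mul_add, mul_assoc (4 * h / c)]
  refine mul_le_mul_of_nonneg_left ((add_le_add nm np).trans_eq ?_) (by positivity)
  ring

lemma norm_J_le (hh : 0 < h) : ∃ B : ℝ, (∀ (j : ℤ) (x : ℝ), |J j h x| ≤ B) ∧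
    ∀ (j : ℤ) (a x : ℝ), |∫ u in a..x, nsinc ((u - j * h) / h)| ≤ B := by
  obtain ⟨B, hB⟩ := exists_abs_integral_nsinc_le hh
  exact ⟨B, fun j x => le_of_tendsto (tendsto_J j hh x).abs
    (Eventually.of_forall fun a => hB j a x), hB⟩

lemma summable_mul_J (hh : 0 < h) (hs : Summable fun j : ℤ => ‖f ((j * h : ℝ) : ℂ)‖) (x : ℝ) :
    Summable fun j : ℤ => f ((j * h : ℝ) : ℂ) * (J j h x : ℂ) := by
  obtain ⟨B, hB, -⟩ := norm_J_le hh
  refine (hs.mul_right B).of_norm_bounded fun j => ?_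
  rw [norm_mul, Complex.norm_real]
  gcongr
  exact hB j x

/-- The bound on [a, x] does not depend on `a`, so it survives a → -∞: the integral converges
because f is integrable on ℝ, the series by dominated convergence. -/
lemma enorm_integral_Iic_sub_tsum_le (hf : InB f d) (hc : 0 < c) (hcd : c < d)
    (hfin : lineIntegral f c ≠ ∞) (hh : 0 < h) (x : ℝ) :
    ‖(∫ t in Iic x, f (t : ℂ)) - ∑' j : ℤ, f ((j * h : ℝ) : ℂ) * (J j h x : ℂ)‖ₑ ≤
      ENNReal.ofReal (4 * h * Real.exp (-Real.pi * c / h) /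
        (Real.pi * c * (1 - Real.exp (-2 * Real.pi * c / h)))) * lineIntegral f c := by
  have hs := summable_norm_lattice hf hc hcd hfin hh
  obtain ⟨B, -, hB⟩ := norm_J_le hh
  have h1 := intervalIntegral_tendsto_integral_Iic x
    (integrable_real_line hf hc hcd hfin).integrableOn tendsto_id
  have h2 : Tendsto (fun a : ℝ => ∑' j : ℤ, f ((j * h : ℝ) : ℂ) *
      ((∫ t in a..x, nsinc ((t - j * h) / h) : ℝ) : ℂ)) atBot
      (𝓝 (∑' j : ℤ, f ((j * h : ℝ) : ℂ) * (J j h x : ℂ))) := by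
    refine tendsto_tsum_of_dominated_convergence (hs.mul_right B) (fun j => ?_)
      (Eventually.of_forall fun a j => ?_)
    · exact ((Complex.continuous_ofReal.tendsto _).comp (tendsto_J j hh x)).const_mul _
    · rw [norm_mul, Complex.norm_real]
      gcongr
      exact hB j a x
  refine le_of_tendsto (h1.sub h2).enorm ?_
  filter_upwards [eventually_le_atBot x] with a ha
  exact norm_integral_sub_tsum_le hf hc hcd hfin hh ha

lemma tendsto_error_bound (hf : InB f d) (hd : 0 < d) (hh : 0 < h) :
    Tendsto (fun c : ℝ => ENNReal.ofReal (4 * h * Real.exp (-Real.pi * c / h) /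
        (Real.pi * c * (1 - Real.exp (-2 * Real.pi * c / h)))) * lineIntegral f c) (𝓝[<] d)
      (𝓝 (ENNReal.ofReal (4 * h * Real.exp (-Real.pi * d / h) /
        (Real.pi * d * (1 - Real.exp (-2 * Real.pi * d / h)))) * Lam f d)) := by
  refine ENNReal.Tendsto.mul (ENNReal.tendsto_ofReal ?_) (.inr hf.Lam_lt_top.ne) hf.tendsto_Lam
    (.inr ENNReal.ofReal_ne_top)
  refine ContinuousAt.continuousWithinAt (ContinuousAt.div (by fun_prop) (by fun_prop) ?_)
  have hexp : Real.exp (-2 * Real.pi * d / h) < 1 := by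
    rw [Real.exp_lt_one_iff]
    have := Real.pi_pos
    exact div_neg_of_neg_of_pos (by nlinarith [mul_pos this hd]) hh
  exact mul_ne_zero (mul_ne_zero Real.pi_ne_zero hd.ne') (sub_pos.2 hexp).ne'

end

end SincIndef

theorem theorem4p4 (f : ℂ → ℂ) (d : ℝ) (hd : 0 < d) (hf : SincIndef.InB f d)
    (h : ℝ) (hh : 0 < h) :
    Integrable (fun t : ℝ => f t) ∧
    (∀ x : ℝ, Summable (fun j : ℤ => f ((j * h : ℝ) : ℂ) * (SincIndef.J j h x : ℂ))) ∧
    (⨆ x : ℝ, ‖(∫ t in Iic x, f (t : ℂ)) -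
        ∑' j : ℤ, f ((j * h : ℝ) : ℂ) * (SincIndef.J j h x : ℂ)‖ₑ) ≤
      ENNReal.ofReal (4 * h * Real.exp (-Real.pi * d / h) /
        (Real.pi * d * (1 - Real.exp (-2 * Real.pi * d / h)))) * SincIndef.Lam f d := by
  -- Finiteness of the limit Λ makes the line integral finite only for c near d, which is all that
  -- is needed.
  have hev : ∀ᶠ c in 𝓝[<] d, 0 < c ∧ c < d ∧ SincIndef.lineIntegral f c ≠ ∞ := by
    filter_upwards [self_mem_nhdsWithin, nhdsWithin_le_nhds (lt_mem_nhds hd),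
      hf.tendsto_Lam.eventually (gt_mem_nhds hf.Lam_lt_top)] with c h1 h2 h3
    exact ⟨h2, h1, h3.ne⟩
  obtain ⟨c, hc, hcd, hfin⟩ := hev.exists
  refine ⟨SincIndef.integrable_real_line hf hc hcd hfin, SincIndef.summable_mul_J hh
    (SincIndef.summable_norm_lattice hf hc hcd hfin hh), iSup_le fun x => ?_⟩
  refine ge_of_tendsto (SincIndef.tendsto_error_bound hf hd hh) (hev.mono fun c hc => ?_)
  exact SincIndef.enorm_integral_Iic_sub_tsum_le hf hc.1 hc.2.1 hc.2.2 hh x
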